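/- Let $K$ be a field of characteristic zero and $S=K[x_1,x_2,x_3]$. For a finite set $\mathcal{A}$ of planes through the origin in $K^3$ (a central arrangement), write each $H\in\mathcal{A}$ as $H=\ker\alpha_H$ with a linear form $\alpha_H\neq 0$, put $Q(\mathcal{A})=\prod_{H\in\mathcal{A}}\alpha_H$, and let $$D(\mathcal{A})=\{\theta\in\operatorname{Der}_K(S)\mid \theta(Q(\mathcal{A}))\in Q(\mathcal{A})S\}$$ be its $S$-module of logarithmic derivations. A derivation $\theta=\sum_i p_i\,\partial/\partial x_i$ is homogeneous of degree $d$ if all $p_i$ are homogeneous polynomials of degree $d$; $\theta_E=\sum_i x_i\,\partial/\partial x_i$ is the Euler derivation. For $H\in\mathcal{A}$ let $\mathcal{A}^H=\{H'\cap H\mid H'\in\mathcal{A},\ H'\neq H\}$. The arrangement $\mathcal{A}$ is free if $D(\mathcal{A})$ is a free $S$-module, and its exponents are then the degrees, in increasing order, of a minimal system of homogeneous generators of $D(\mathcal{A})$. Let $\mathcal{A}'$ be a central arrangement in $K^3$ such that $D(\mathcal{A}')$ has a minimal system of homogeneous generators $\theta_E,\theta_1,\theta_2,\theta_3$ with $\deg\theta_i=d_i$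 for $i=1,2,3$ and $1\le d_1\le d_2\le d_3$. Let $H\notin\mathcal{A}'$ be a plane through the origin, and put $\mathcal{A}=\mathcal{A}'\cup\{H\}$. If $|\mathcal{A}'|-|\mathcal{A}^H|=d_3$ and $1+d_1+d_2=|\mathcal{A}|$, then $\mathcal{A}$ is free with exponents $(1,d_1,d_2)$. -/

import Mathlib

namespace HypArr

/-- The polynomial coordinate ring `S = K[x_1, …, x_ℓ]` of `V = K^ℓ`. -/
abbrev CoordRing (K : Type*) [Field K] (l : ℕ) : Type _ := MvPolynomial (Fin l) K

/-- The `S`-module `Der(S)` of `K`-linear derivations of `S`. -/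
abbrev Der (K : Type*) [Field K] (l : ℕ) : Type _ :=
  Derivation K (CoordRing K l) (CoordRing K l)

/-- A hyperplane of `K^ℓ` through the origin: the kernel of a nonzero linear form. -/
def IsHyperplane {K : Type*} [Field K] {l : ℕ} (H : Submodule K (Fin l → K)) : Prop :=
  ∃ α : Module.Dual K (Fin l → K), α ≠ 0 ∧ LinearMap.ker α = H

/-- A central arrangement in `K^ℓ`: a finite set of hyperplanes through the origin. -/
structure CentralArrangement (K : Type*) [Field K] (l : ℕ) where
  planes : Finset (Submodule K (Fin l → K))
  isHyperplane : ∀ H ∈ planes, IsHyperplane H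

/-- A linear form on `K^ℓ`, seen as an element of `S`. -/
noncomputable def formPoly {K : Type*} [Field K] {l : ℕ} (α : Module.Dual K (Fin l → K)) :
    CoordRing K l :=
  ∑ i, MvPolynomial.C (α (Pi.single i 1)) * MvPolynomial.X i

open Classical in
/-- A linear form `α_H ∈ S` with kernel `H` (unique up to a nonzero scalar), for a
hyperplane `H`; the value for other subspaces is never used. -/
noncomputable def definingForm {K : Type*} [Field K] {l : ℕ} (H : Submodule K (Fin l → K)) :
    CoordRing K l :=
  if h : IsHyperplane H then formPoly h.choose else 0

/-- The Euler derivation `θ_E = ∑ x_i ∂/∂x_i`. -/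
noncomputable def eulerDer (K : Type*) [Field K] (l : ℕ) : Der K l :=
  MvPolynomial.mkDerivation K MvPolynomial.X

/-- `θ = ∑ p_i ∂/∂x_i` is homogeneous of degree `d`: every `p_i = θ(x_i)` is homogeneous of
(total polynomial) degree `d`. -/
def IsHomogeneousDer {K : Type*} [Field K] {l : ℕ} (θ : Der K l) (d : ℕ) : Prop :=
  ∀ i, (θ (MvPolynomial.X i)).IsHomogeneous d

namespace CentralArrangement

/-- `|A|`. -/
def card {K : Type*} [Field K] {l : ℕ} (A : CentralArrangement K l) : ℕ := A.planes.card

/-- The defining polynomial `Q(A) = ∏_{H ∈ A} α_H`. -/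
noncomputable def definingPoly {K : Type*} [Field K] {l : ℕ} (A : CentralArrangement K l) :
    CoordRing K l :=
  ∏ H ∈ A.planes, definingForm H

/-- The module of logarithmic derivations `D(A) = {θ ∈ Der(S) | θ(Q(A)) ∈ Q(A) S}`. -/
noncomputable def logDer {K : Type*} [Field K] {l : ℕ} (A : CentralArrangement K l) :
    Submodule (CoordRing K l) (Der K l) where
  carrier := {θ | A.definingPoly ∣ θ A.definingPoly}
  add_mem' := fun ha hb => by
    simpa only [Set.mem_ofPred_eq, Derivation.add_apply] using dvd_add ha hb
  zero_mem' := by simp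
  smul_mem' := fun c x hx => by
    simpa only [Set.mem_ofPred_eq, Derivation.smul_apply, smul_eq_mul] using hx.mul_left c

open Classical in
/-- `A ∪ {H}`. -/
noncomputable def addPlane {K : Type*} [Field K] {l : ℕ} (A : CentralArrangement K l)
    (H : Submodule K (Fin l → K)) (hH : IsHyperplane H) : CentralArrangement K l where
  planes := insert H A.planes
  isHyperplane := by
    intro H' h
    rcases Finset.mem_insert.mp h with rfl | h
    · exact hH
    · exact A.isHyperplane H' h

open Classical in
/-- The restriction `A^H = {H' ∩ H | H' ∈ A, H' ≠ H}`, an arrangement of hyperplanes of `H`. -/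
noncomputable def restriction {K : Type*} [Field K] {l : ℕ} (A : CentralArrangement K l)
    (H : Submodule K (Fin l → K)) : Finset (Submodule K (Fin l → K)) :=
  (A.planes.erase H).image (fun H' => H' ⊓ H)

/-- `θ_1, …, θ_k` is a minimal system of homogeneous generators of the `S`-module `D(A)`,
with `deg θ_i = d_i`. -/
structure IsMinimalGenerators {K : Type*} [Field K] {l : ℕ} (A : CentralArrangement K l)
    {k : ℕ} (θ : Fin k → Der K l) (d : Fin k → ℕ) : Prop where
  homogeneous : ∀ i, IsHomogeneousDer (θ i) (d i)
  span_eq : Submodule.span (CoordRing K l) (Set.range θ) = A.logDer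
  irredundant : ∀ i, θ i ∉ Submodule.span (CoordRing K l) (θ '' {i}ᶜ)

/-- `(d_1, …, d_k)` is the derivation degree sequence of `A`: the degrees, in increasing
order, of a minimal system of homogeneous generators of `D(A)`. -/
def IsDegreeSequence {K : Type*} [Field K] {l : ℕ} (A : CentralArrangement K l)
    {k : ℕ} (d : Fin k → ℕ) : Prop :=
  Monotone d ∧ ∃ θ : Fin k → Der K l, A.IsMinimalGenerators θ d

/-- `A` is free: `D(A)` is a free `S`-module. -/
def IsFree {K : Type*} [Field K] {l : ℕ} (A : CentralArrangement K l) : Prop :=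
  Module.Free (CoordRing K l) A.logDer

/-- `A` is free with exponents `(d_1, …, d_k)`. -/
def IsFreeWithExponents {K : Type*} [Field K] {l : ℕ} (A : CentralArrangement K l)
    {k : ℕ} (d : Fin k → ℕ) : Prop :=
  A.IsFree ∧ A.IsDegreeSequence d

end CentralArrangement

end HypArr

/-! Fix a linear form `α` with kernel `H`. Terao's polynomial `b`, of degree `|A'| - |A^H| = d₃`,
divides the restriction to `H` of `θ(α)` for every `θ ∈ D(A')` (`exists_dvd_elimination`). Since no
`dᵢ` exceeds `d₃`, this restriction equals `cᵢ b` for `θᵢ`, with a constant `cᵢ` that vanishes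
unless `dᵢ = d₃`. If `c₃ ≠ 0`, subtracting `(cᵢ/c₃) θ₃` from `θ₁` and `θ₂` puts both in `D(A)`
without changing degrees. If all `cᵢ` vanish nothing need be subtracted, and in the remaining cases
a tie of degrees lets another generator play the part of `θ₃`.

The Euler derivation and the two corrected derivations have degrees summing to `|A|`, so Saito's
criterion (`logDer_eq_span_of_linearIndependent`) finishes once they are independent. That is
`linearIndependent_of_generators`: a relation between the two, taken modulo `θ_E`, would exhibit a
nonzero logarithmic derivation of degree below `d₁` that is not a multiple of `θ_E`, which the
degrees of the generators exclude. -/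

namespace HypArr

open MvPolynomial

/-! ### Linear forms as polynomials: irreducibility and coprimality. -/

section LinearForms

variable {K : Type*} [Field K] {l : ℕ}

theorem formPoly_isHomogeneous (α : Module.Dual K (Fin l → K)) :
    (formPoly α).IsHomogeneous 1 :=
  IsHomogeneous.sum _ _ _ fun i _ => isHomogeneous_C_mul_X _ i

theorem coeff_formPoly (α : Module.Dual K (Fin l → K)) (i : Fin l) :
    coeff (Finsupp.single i 1) (formPoly α) = α (Pi.single i 1) := by
  classical
  simp [formPoly, coeff_sum, coeff_C_mul, coeff_X, Finsupp.single_left_inj]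

theorem formPoly_injective :
    Function.Injective (formPoly : Module.Dual K (Fin l → K) → CoordRing K l) := by
  intro α β h
  refine LinearMap.pi_ext' fun i => LinearMap.ext_ring ?_
  simpa [coeff_formPoly] using congrArg (coeff (Finsupp.single i 1)) h

theorem formPoly_add (α β : Module.Dual K (Fin l → K)) :
    formPoly (α + β) = formPoly α + formPoly β := by
  simp [formPoly, add_mul, Finset.sum_add_distrib]

theorem formPoly_smul (c : K) (α : Module.Dual K (Fin l → K)) :
    formPoly (c • α) = C c * formPoly α := by
  simp [formPoly, Finset.mul_sum, mul_assoc]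

theorem formPoly_sub_smul (γ α : Module.Dual K (Fin l → K)) (c : K) :
    formPoly (γ - c • α) = formPoly γ - C c * formPoly α := by
  simp [formPoly, sub_mul, Finset.sum_sub_distrib, Finset.mul_sum, mul_assoc]

theorem formPoly_zero : formPoly (0 : Module.Dual K (Fin l → K)) = 0 := by
  simp [formPoly]

theorem formPoly_ne_zero {α : Module.Dual K (Fin l → K)} (hα : α ≠ 0) : formPoly α ≠ 0 :=
  fun h => hα (formPoly_injective (h.trans formPoly_zero.symm))

theorem irreducible_formPoly {α : Module.Dual K (Fin l → K)} (hα : α ≠ 0) :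
    Irreducible (formPoly α) := by
  have h1 := (formPoly_isHomogeneous α).totalDegree (formPoly_ne_zero hα)
  refine irreducible_of_totalDegree_eq_one h1 fun x hx => ?_
  have : x ≠ 0 := by
    rintro rfl
    refine formPoly_ne_zero hα (MvPolynomial.ext _ _ fun m => ?_)
    simpa using hx m
  exact this.isUnit

theorem exists_smul_eq_of_formPoly_dvd {α β : Module.Dual K (Fin l → K)} (hβ : β ≠ 0)
    (h : formPoly α ∣ formPoly β) : ∃ c : K, c ≠ 0 ∧ β = c • α := by
  obtain ⟨q, hq⟩ := h
  have hβ0 := formPoly_ne_zero hβ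
  have hα0 : formPoly α ≠ 0 := by rintro h0; simp [hq, h0] at hβ0
  have hq0 : q ≠ 0 := by rintro rfl; simp [hq] at hβ0
  have hd := congrArg totalDegree hq
  rw [totalDegree_mul_of_isDomain hα0 hq0, (formPoly_isHomogeneous α).totalDegree hα0,
    (formPoly_isHomogeneous β).totalDegree hβ0] at hd
  have hq' := totalDegree_eq_zero_iff_eq_C.mp (show q.totalDegree = 0 by omega)
  have hb : β = coeff 0 q • α := by
    apply formPoly_injective
    rw [formPoly_smul, ← hq', mul_comm, hq]
  refine ⟨coeff 0 q, fun h0 => hβ ?_, hb⟩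
  rw [hb, h0, zero_smul]

theorem isRelPrime_formPoly {α β : Module.Dual K (Fin l → K)} (hα : α ≠ 0) (hβ : β ≠ 0)
    (h : LinearMap.ker α ≠ LinearMap.ker β) : IsRelPrime (formPoly α) (formPoly β) := by
  rw [(irreducible_formPoly hα).isRelPrime_iff_not_dvd]
  intro hd
  obtain ⟨c, hc, rfl⟩ := exists_smul_eq_of_formPoly_dvd hβ hd
  exact h (LinearMap.ker_smul α c hc).symm

theorem definingForm_eq_formPoly {H : Submodule K (Fin l → K)} (hH : IsHyperplane H) :
    ∃ α : Module.Dual K (Fin l → K), α ≠ 0 ∧ LinearMap.ker α = H ∧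
      definingForm H = formPoly α := by
  refine ⟨hH.choose, hH.choose_spec.1, hH.choose_spec.2, ?_⟩
  simp [definingForm, hH]

theorem prime_definingForm {H : Submodule K (Fin l → K)} (hH : IsHyperplane H) :
    Prime (definingForm H) := by
  obtain ⟨α, hα, -, h⟩ := definingForm_eq_formPoly hH
  rw [h]
  exact (irreducible_formPoly hα).prime

theorem definingForm_isHomogeneous {H : Submodule K (Fin l → K)} (hH : IsHyperplane H) :
    (definingForm H).IsHomogeneous 1 := by
  obtain ⟨α, -, -, h⟩ := definingForm_eq_formPoly hH
  rw [h]
  exact formPoly_isHomogeneous α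

theorem isRelPrime_definingForm {H H' : Submodule K (Fin l → K)} (hH : IsHyperplane H)
    (hH' : IsHyperplane H') (h : H ≠ H') : IsRelPrime (definingForm H) (definingForm H') := by
  obtain ⟨α, hα, rfl, e⟩ := definingForm_eq_formPoly hH
  obtain ⟨β, hβ, rfl, e'⟩ := definingForm_eq_formPoly hH'
  rw [e, e']
  exact isRelPrime_formPoly hα hβ h

theorem derivation_formPoly (θ : Der K l) (α : Module.Dual K (Fin l → K)) :
    θ (formPoly α) = ∑ i, C (α (Pi.single i 1)) * θ (X i) := by
  simp [formPoly, ← algebraMap_eq]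

theorem isHomogeneous_derivation_formPoly {θ : Der K l} {d : ℕ} (hθ : IsHomogeneousDer θ d)
    (α : Module.Dual K (Fin l → K)) : (θ (formPoly α)).IsHomogeneous d := by
  rw [derivation_formPoly]
  exact IsHomogeneous.sum _ _ _ fun i _ => (hθ i).C_mul _

theorem eulerDer_X (i : Fin l) : eulerDer K l (X i) = X i :=
  mkDerivation_X _ _ _

theorem eulerDer_formPoly (α : Module.Dual K (Fin l → K)) :
    eulerDer K l (formPoly α) = formPoly α := by
  simp [eulerDer_X, formPoly]

theorem isHomogeneousDer_eulerDer : IsHomogeneousDer (eulerDer K l) 1 := fun i => by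
  rw [eulerDer_X]
  exact isHomogeneous_X K i

end LinearForms

/-! ### Logarithmic derivations, tested one hyperplane at a time. -/

section LogDer

variable {K : Type*} [Field K] {l : ℕ}

theorem prod_dvd_derivation_prod {ι R : Type*} [CommRing R] [Algebra K R]
    (θ : Derivation K R R) (s : Finset ι) (f : ι → R) (h : ∀ i ∈ s, f i ∣ θ (f i)) :
    ∏ i ∈ s, f i ∣ θ (∏ i ∈ s, f i) := by
  classical
  induction s using Finset.induction_on with
  | empty => simp
  | insert a s ha ih =>
    rw [Finset.prod_insert ha, Derivation.leibniz, smul_eq_mul, smul_eq_mul]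
    refine dvd_add (mul_dvd_mul_left _ (ih fun i hi => h i (Finset.mem_insert_of_mem hi))) ?_
    rw [mul_comm]
    exact mul_dvd_mul_left _ (h a (Finset.mem_insert_self _ _))

namespace CentralArrangement

/-- By the product rule, `α_H` divides `θ(α_H)` times the product of the other forms, and that
product is coprime to `α_H`. In this local form, adding a plane just adds one condition. -/
theorem mem_logDer_iff (A : CentralArrangement K l) (θ : Der K l) :
    θ ∈ A.logDer ↔ ∀ H ∈ A.planes, definingForm H ∣ θ (definingForm H) := by
  classical
  refine ⟨fun h H hH => ?_, fun h => prod_dvd_derivation_prod θ _ _ h⟩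
  have h' : A.definingPoly ∣ θ A.definingPoly := h
  have hQ : A.definingPoly = definingForm H * ∏ H' ∈ A.planes.erase H, definingForm H' :=
    (Finset.mul_prod_erase _ _ hH).symm
  have hd : definingForm H ∣ θ A.definingPoly := (Dvd.intro _ hQ.symm).trans h'
  rw [hQ, Derivation.leibniz, smul_eq_mul, smul_eq_mul,
    dvd_add_right (dvd_mul_right _ _)] at hd
  refine IsRelPrime.dvd_of_dvd_mul_left ?_ hd
  exact IsRelPrime.prod_right fun H' hH' =>
    isRelPrime_definingForm (A.isHyperplane H hH)
      (A.isHyperplane H' (Finset.mem_of_mem_erase hH')) (Finset.ne_of_mem_erase hH').symm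

theorem mem_logDer_addPlane_iff (A : CentralArrangement K l) {H : Submodule K (Fin l → K)}
    (hH : IsHyperplane H) (θ : Der K l) :
    θ ∈ (A.addPlane H hH).logDer ↔ definingForm H ∣ θ (definingForm H) ∧ θ ∈ A.logDer := by
  classical
  simp [mem_logDer_iff, addPlane]

theorem eulerDer_mem_logDer (A : CentralArrangement K l) : eulerDer K l ∈ A.logDer := by
  rw [mem_logDer_iff]
  intro H hH
  obtain ⟨α, -, -, h⟩ := definingForm_eq_formPoly (A.isHyperplane H hH)
  rw [h, eulerDer_formPoly]

theorem definingPoly_isHomogeneous (A : CentralArrangement K l) :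
    A.definingPoly.IsHomogeneous A.card := by
  have := IsHomogeneous.prod A.planes definingForm (fun _ => 1)
    fun H hH => definingForm_isHomogeneous (A.isHyperplane H hH)
  simpa [card, definingPoly] using this

theorem definingPoly_ne_zero (A : CentralArrangement K l) : A.definingPoly ≠ 0 :=
  Finset.prod_ne_zero_iff.mpr fun H hH => (prime_definingForm (A.isHyperplane H hH)).ne_zero

theorem definingPoly_dvd (A : CentralArrangement K l) {f : CoordRing K l}
    (h : ∀ H ∈ A.planes, definingForm H ∣ f) : A.definingPoly ∣ f :=
  Finset.prod_dvd_of_isRelPrime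
    (fun H hH H' hH' hne => isRelPrime_definingForm (A.isHyperplane H hH)
      (A.isHyperplane H' hH') hne) h

end CentralArrangement

end LogDer

/-! ### Coefficient determinants and Saito's criterion. -/

section Saito

variable {K : Type*} [Field K] {l : ℕ}

/-- The coefficient matrix of a family of `l` derivations. -/
noncomputable def coeffMatrix (θ : Fin l → Der K l) :
    Matrix (Fin l) (Fin l) (CoordRing K l) :=
  Matrix.of fun i j => θ i (X j)

theorem derivation_eq_sum_smul_iff (θ : Fin l → Der K l) (c : Fin l → CoordRing K l)
    (ψ : Der K l) :
    ψ = ∑ i, c i • θ i ↔ (fun j => ψ (X j)) = Matrix.vecMul c (coeffMatrix θ) := by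
  have key : ∀ j, (∑ i, c i • θ i) (X j) = Matrix.vecMul c (coeffMatrix θ) j := by
    intro j
    rw [← Derivation.coeFnAddMonoidHom_apply, map_sum, Finset.sum_apply]
    simp [coeffMatrix, Matrix.vecMul, dotProduct]
  constructor
  · rintro rfl
    exact funext key
  · intro h
    exact derivation_ext fun j => (congrFun h j).trans (key j).symm

theorem coeffMatrix_det_ne_zero_iff (θ : Fin l → Der K l) :
    (coeffMatrix θ).det ≠ 0 ↔ LinearIndependent (CoordRing K l) θ := by
  rw [Ne, ← Matrix.exists_vecMul_eq_zero_iff, Fintype.linearIndependent_iff]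
  have h0 : (fun j => (0 : Der K l) (X j)) = 0 := rfl
  constructor
  · intro h c hc i
    by_contra hi
    refine h ⟨c, fun h' => hi (congrFun h' i), ?_⟩
    rw [← (derivation_eq_sum_smul_iff θ c 0).mp hc.symm, h0]
  · rintro h ⟨c, hc, hc0⟩
    exact hc (funext (h c ((derivation_eq_sum_smul_iff θ c 0).mpr (h0.trans hc0.symm)).symm))

theorem coeffMatrix_det_isHomogeneous {θ : Fin l → Der K l} {d : Fin l → ℕ}
    (hθ : ∀ i, IsHomogeneousDer (θ i) (d i)) :
    (coeffMatrix θ).det.IsHomogeneous (∑ i, d i) := by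
  rw [← Matrix.det_transpose, Matrix.det_apply]
  refine IsHomogeneous.sum _ _ _ fun σ _ => ?_
  have hp := IsHomogeneous.prod Finset.univ (fun i => (coeffMatrix θ).transpose (σ i) i) d
    fun i _ => hθ i (σ i)
  rcases Int.units_eq_one_or (Equiv.Perm.sign σ) with h | h <;> rw [h]
  · simpa using hp
  · simpa using hp.neg

namespace CentralArrangement

/-- Modulo `α_H` the coefficient matrix kills the nonzero constant vector of coefficients of `α_H`.
Multiplying by the adjugate shows that `α_H` divides the determinant, and distinct forms are
coprime. -/
theorem definingPoly_dvd_coeffMatrix_det (A : CentralArrangement K l) {θ : Fin l → Der K l}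
    (hθ : ∀ i, θ i ∈ A.logDer) : A.definingPoly ∣ (coeffMatrix θ).det := by
  refine A.definingPoly_dvd fun H hH => ?_
  obtain ⟨α, hα, -, h⟩ := definingForm_eq_formPoly (A.isHyperplane H hH)
  obtain ⟨j, hj⟩ : ∃ j, α (Pi.single j 1) ≠ 0 := by
    by_contra! hc
    exact hα (LinearMap.pi_ext' fun i => LinearMap.ext_ring (by simpa using hc i))
  set M := coeffMatrix θ
  set a : Fin l → CoordRing K l := fun i => C (α (Pi.single i 1))
  have hMa : ∀ i, definingForm H ∣ M.mulVec a i := by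
    intro i
    have := (A.mem_logDer_iff _).mp (hθ i) H hH
    rw [h, derivation_formPoly] at this
    rw [h]
    simpa [M, a, Matrix.mulVec, dotProduct, coeffMatrix, mul_comm] using this
  have hadj : M.adjugate.mulVec (M.mulVec a) = M.det • a := by
    rw [Matrix.mulVec_mulVec, Matrix.adjugate_mul, Matrix.smul_mulVec, Matrix.one_mulVec]
  have hd : definingForm H ∣ M.det * C (α (Pi.single j 1)) := by
    have e := congrFun hadj j
    rw [Pi.smul_apply, smul_eq_mul] at e
    rw [← e, Matrix.mulVec, dotProduct]
    exact Finset.dvd_sum fun i _ => Dvd.dvd.mul_left (hMa i) (M.adjugate j i)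
  exact (IsUnit.dvd_mul_right ((hj.isUnit).map C)).mp hd

/-- Saito's criterion. -/
theorem logDer_eq_span_of_linearIndependent (A : CentralArrangement K l)
    {θ : Fin l → Der K l} {d : Fin l → ℕ} (hmem : ∀ i, θ i ∈ A.logDer)
    (hhom : ∀ i, IsHomogeneousDer (θ i) (d i)) (hli : LinearIndependent (CoordRing K l) θ)
    (hd : ∑ i, d i = A.card) :
    Submodule.span (CoordRing K l) (Set.range θ) = A.logDer := by
  classical
  have hdet := (coeffMatrix_det_ne_zero_iff θ).mpr hli
  obtain ⟨q, hq⟩ := A.definingPoly_dvd_coeffMatrix_det hmem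
  have hq0 : q ≠ 0 := by rintro rfl; simp [hq] at hdet
  have hdeg := congrArg totalDegree hq
  rw [totalDegree_mul_of_isDomain A.definingPoly_ne_zero hq0,
    (coeffMatrix_det_isHomogeneous hhom).totalDegree hdet,
    A.definingPoly_isHomogeneous.totalDegree A.definingPoly_ne_zero] at hdeg
  -- The determinant and `Q(A)` have the same degree, so they differ by a nonzero constant.
  have hqC := totalDegree_eq_zero_iff_eq_C.mp (show q.totalDegree = 0 by omega)
  have hqu : IsUnit q := by
    rw [hqC] at hq0 ⊢
    exact (IsUnit.mk0 _ (fun h => hq0 (by rw [h, C_0]))).map C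
  refine le_antisymm (Submodule.span_le.mpr (Set.range_subset_iff.mpr hmem)) fun ψ hψ => ?_
  -- Each Cramer numerator is the determinant of another family in `D(A)`, with `ψ` replacing `θ i`.
  -- It is divisible by `Q(A)`, hence by `det`, so the Cramer coefficients of `ψ` are polynomials.
  have hdvd : ∀ i, ∃ c, (Matrix.cramer (coeffMatrix θ).transpose fun j => ψ (X j)) i =
      (coeffMatrix θ).det * c := by
    intro i
    have hu : (coeffMatrix θ).updateRow i (fun j => ψ (X j)) =
        coeffMatrix (Function.update θ i ψ) := by
      ext a b
      by_cases hab : a = i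
      · subst hab; simp [coeffMatrix]
      · simp [coeffMatrix, hab]
    rw [Matrix.cramer_transpose_apply, hu, hq]
    have : A.definingPoly * q ∣ (coeffMatrix (Function.update θ i ψ)).det := by
      rw [hqu.mul_right_dvd]
      refine A.definingPoly_dvd_coeffMatrix_det fun k => ?_
      by_cases hk : k = i
      · subst hk; simpa using hψ
      · simpa [hk] using hmem k
    exact this
  choose c hc using hdvd
  have hψc : ψ = ∑ i, c i • θ i := by
    rw [derivation_eq_sum_smul_iff]
    have h := Matrix.mulVec_cramer (coeffMatrix θ).transpose fun j => ψ (X j)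
    rw [show (Matrix.cramer (coeffMatrix θ).transpose fun j => ψ (X j)) =
      (coeffMatrix θ).det • c from funext hc, Matrix.mulVec_smul, Matrix.mulVec_transpose,
      Matrix.det_transpose] at h
    exact (smul_right_injective _ hdet h).symm
  rw [hψc]
  exact Submodule.sum_mem _ fun i _ => Submodule.smul_mem _ _
    (Submodule.subset_span (Set.mem_range_self i))

theorem isFreeWithExponents_of_linearIndependent (A : CentralArrangement K l)
    {θ : Fin l → Der K l} {d : Fin l → ℕ} (hmem : ∀ i, θ i ∈ A.logDer)
    (hhom : ∀ i, IsHomogeneousDer (θ i) (d i)) (hli : LinearIndependent (CoordRing K l) θ)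
    (hd : ∑ i, d i = A.card) (hmono : Monotone d) : A.IsFreeWithExponents d := by
  have hspan := A.logDer_eq_span_of_linearIndependent hmem hhom hli hd
  refine ⟨?_, hmono, θ, hhom, hspan, fun i hi => ?_⟩
  · have : Module.Free (CoordRing K l) (Submodule.span (CoordRing K l) (Set.range θ)) :=
      Module.Free.of_basis (Module.Basis.span hli)
    rw [hspan] at this
    exact this
  · exact hli.notMem_span_image (s := {i}ᶜ) (x := i) (by simp) hi

end CentralArrangement

end Saito

end HypArr

namespace HypArr

open MvPolynomial

/-! ### Restriction to a hyperplane and Terao's polynomial. -/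

section Elimination

variable {K : Type*} [Field K] {l : ℕ}

/-- A linear substitution that eliminates one variable along the linear form `α`. -/
theorem exists_elimination {α : Module.Dual K (Fin l → K)} (hα : α ≠ 0) :
    ∃ π : CoordRing K l →ₐ[K] CoordRing K l,
      (∀ f, π f = 0 ↔ formPoly α ∣ f) ∧
      (∀ f d, IsHomogeneous f d → IsHomogeneous (π f) d) ∧
      ∀ γ, ∃ c : K, π (formPoly γ) = formPoly (γ - c • α) := by
  classical
  obtain ⟨j, hj⟩ : ∃ j, α (Pi.single j 1) ≠ 0 := by
    by_contra! hc
    exact hα (LinearMap.pi_ext' fun i => LinearMap.ext_ring (by simpa using hc i))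
  -- Only `x_j` moves, to `x_j - α / α(e_j)`. This kills `α` and changes every polynomial by a
  -- multiple of `α`.
  set g : Fin l → CoordRing K l := fun k =>
    X k - C (Pi.single (M := fun _ => K) j (α (Pi.single j 1))⁻¹ k) * formPoly α with hg
  have hform : ∀ γ, aeval g (formPoly γ) =
      formPoly (γ - (γ (Pi.single j 1) * (α (Pi.single j 1))⁻¹) • α) := by
    intro γ
    rw [formPoly_sub_smul]
    have : aeval g (formPoly γ) = formPoly γ - ∑ k, C (γ (Pi.single k 1)) *
        (C (Pi.single (M := fun _ => K) j (α (Pi.single j 1))⁻¹ k) * formPoly α) := by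
      rw [formPoly, map_sum, ← Finset.sum_sub_distrib]
      refine Finset.sum_congr rfl fun k _ => ?_
      simp [hg, algebraMap_eq, mul_sub]
    rw [this, Finset.sum_eq_single j]
    · simp only [Pi.single_eq_same, C_mul]
      ring
    · intro k _ hk
      simp [hk]
    · simp
  have hdvd : ∀ f, formPoly α ∣ f - aeval g f := by
    intro f
    induction f using MvPolynomial.induction_on with
    | C a => simp [algebraMap_eq]
    | add p q hp hq =>
      rw [map_add, add_sub_add_comm]
      exact dvd_add hp hq
    | mul_X p k hp =>
      have hX : formPoly α ∣ X k - g k := by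
        rw [hg, sub_sub_cancel]
        exact dvd_mul_left _ _
      rw [map_mul, aeval_X,
        show p * X k - aeval g p * g k = (p - aeval g p) * X k + aeval g p * (X k - g k) by ring]
      exact dvd_add (hp.mul_right _) (hX.mul_left _)
  refine ⟨aeval g, fun f => ⟨fun h => ?_, ?_⟩, fun f d hf => ?_, fun γ => ⟨_, hform γ⟩⟩
  · have hf := hdvd f
    rwa [h, sub_zero] at hf
  · rintro ⟨q, rfl⟩
    rw [map_mul, hform, mul_inv_cancel₀ hj, one_smul, sub_self, formPoly_zero, zero_mul]
  · have h1 : ∀ k, (g k).IsHomogeneous 1 := fun k =>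
      (isHomogeneous_X K k).sub ((formPoly_isHomogeneous α).C_mul _)
    simpa using hf.aeval g h1

theorem ker_sub_smul_inf_ker (α γ : Module.Dual K (Fin l → K)) (c : K) :
    LinearMap.ker (γ - c • α) ⊓ LinearMap.ker α = LinearMap.ker γ ⊓ LinearMap.ker α := by
  ext v
  simp only [Submodule.mem_inf, LinearMap.mem_ker, LinearMap.sub_apply, LinearMap.smul_apply,
    smul_eq_mul]
  constructor <;> rintro ⟨h, h'⟩ <;> simpa [h'] using h

/-- A form vanishing on `ker β ∩ ker α` lies in the span of `β` and `α`; were the coefficient of `α`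
zero, `γ` and `β` would have the same kernel. -/
theorem exists_eq_smul_add_smul {α β γ : Module.Dual K (Fin l → K)} (hγ : γ ≠ 0)
    (h : LinearMap.ker γ ⊓ LinearMap.ker α = LinearMap.ker β ⊓ LinearMap.ker α)
    (hne : LinearMap.ker γ ≠ LinearMap.ker β) :
    ∃ c e : K, e ≠ 0 ∧ γ = c • β + e • α := by
  have hle : ⨅ i, LinearMap.ker (![β, α] i) ≤ LinearMap.ker γ := by
    refine le_trans ?_ (h.ge.trans inf_le_left)
    exact le_inf (iInf_le_of_le 0 le_rfl) (iInf_le_of_le 1 le_rfl)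
  obtain ⟨w, hw⟩ := (Submodule.mem_span_range_iff_exists_fun K).mp
    (mem_span_of_iInf_ker_le_ker hle)
  have hw' : γ = w 0 • β + w 1 • α := by simpa [Fin.sum_univ_two] using hw.symm
  refine ⟨w 0, w 1, fun h1 => hne ?_, hw'⟩
  rw [h1, zero_smul, add_zero] at hw'
  have h0 : w 0 ≠ 0 := fun h0 => hγ (by rw [hw', h0, zero_smul])
  rw [hw', LinearMap.ker_smul _ _ h0]

namespace CentralArrangement

/-- Terao's polynomial: modulo `α_H`, the values `θ(α_H)` for `θ ∈ D(A)` are divisible by a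
polynomial of degree `|A| - |(A ∪ {H})^H|`. -/
theorem exists_dvd_elimination (A : CentralArrangement K l) {α : Module.Dual K (Fin l → K)}
    (hA : LinearMap.ker α ∉ A.planes) (hH : IsHyperplane (LinearMap.ker α))
    {π : CoordRing K l →ₐ[K] CoordRing K l}
    (hker : ∀ f, π f = 0 ↔ formPoly α ∣ f)
    (hform : ∀ γ, ∃ c : K, π (formPoly γ) = formPoly (γ - c • α)) :
    ∃ (b : CoordRing K l) (n : ℕ), b ≠ 0 ∧ b.IsHomogeneous n ∧
      n + ((A.addPlane _ hH).restriction (LinearMap.ker α)).card = A.card ∧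
      ∀ θ ∈ A.logDer, b ∣ π (θ (formPoly α)) := by
  classical
  set H := LinearMap.ker α
  have hR : (A.addPlane H hH).restriction H = A.planes.image (· ⊓ H) := by
    simp [restriction, addPlane, Finset.erase_insert hA]
  rw [hR]
  set R := A.planes.image (· ⊓ H)
  -- The planes are grouped by their trace on `H`. One representative `s Y` of each group is left
  -- out of `b`, which accounts for the degree `|A| - |R|`.
  have hs : ∀ Y ∈ R, ∃ H' ∈ A.planes, H' ⊓ H = Y := fun Y hY => by simpa [R] using hY
  choose! s hsA hs using hs
  set F : Submodule K (Fin l → K) → Finset (Submodule K (Fin l → K)) := fun Y =>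
    A.planes.filter (· ⊓ H = Y)
  have hπ : ∀ H' ∈ A.planes, ∃ γ : Module.Dual K (Fin l → K), γ ≠ 0 ∧
      LinearMap.ker γ ⊓ H = H' ⊓ H ∧ π (definingForm H') = formPoly γ := by
    intro H' hH'
    obtain ⟨γ, hγ, rfl, e⟩ := definingForm_eq_formPoly (A.isHyperplane H' hH')
    obtain ⟨c, hc⟩ := hform γ
    refine ⟨γ - c • α, fun h0 => ?_, ker_sub_smul_inf_ker α γ c, by rw [e, hc]⟩
    rw [h0, formPoly_zero, hker] at hc
    obtain ⟨k, hk, rfl⟩ := exists_smul_eq_of_formPoly_dvd hγ hc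
    rw [LinearMap.ker_smul _ _ hk] at hH'
    exact hA hH'
  refine ⟨∏ Y ∈ R, ∏ H' ∈ (F Y).erase (s Y), π (definingForm H'),
    ∑ Y ∈ R, ((F Y).erase (s Y)).card, ?_, ?_, ?_, fun θ hθ => ?_⟩
  · refine Finset.prod_ne_zero_iff.mpr fun Y _ => Finset.prod_ne_zero_iff.mpr fun H' hH' => ?_
    obtain ⟨γ, hγ, -, e⟩ := hπ H' (Finset.mem_filter.mp (Finset.mem_of_mem_erase hH')).1
    rw [e]
    exact formPoly_ne_zero hγ
  · refine IsHomogeneous.prod _ _ _ fun Y _ => ?_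
    rw [Finset.card_eq_sum_ones]
    refine IsHomogeneous.prod _ _ _ fun H' hH' => ?_
    obtain ⟨γ, -, -, e⟩ := hπ H' (Finset.mem_filter.mp (Finset.mem_of_mem_erase hH')).1
    rw [e]
    exact formPoly_isHomogeneous γ
  · rw [CentralArrangement.card, Finset.card_eq_sum_card_image (· ⊓ H) A.planes,
      Finset.card_eq_sum_ones, ← Finset.sum_add_distrib]
    refine Finset.sum_congr rfl fun Y hY => Finset.card_erase_add_one ?_
    exact Finset.mem_filter.mpr ⟨hsA Y hY, hs Y hY⟩
  · refine Finset.prod_dvd_of_isRelPrime (fun Y _ Y' _ hne => ?_) fun Y hY => ?_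
    · refine IsRelPrime.prod_left fun H₁ h₁ => IsRelPrime.prod_right fun H₂ h₂ => ?_
      obtain ⟨hA₁, rfl⟩ := Finset.mem_filter.mp (Finset.mem_of_mem_erase h₁)
      obtain ⟨hA₂, rfl⟩ := Finset.mem_filter.mp (Finset.mem_of_mem_erase h₂)
      obtain ⟨γ₁, hγ₁, k₁, e₁⟩ := hπ H₁ hA₁
      obtain ⟨γ₂, hγ₂, k₂, e₂⟩ := hπ H₂ hA₂
      rw [e₁, e₂]
      exact isRelPrime_formPoly hγ₁ hγ₂ fun h => hne (by rw [← k₁, ← k₂, h])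
    · rw [mem_logDer_iff] at hθ
      obtain ⟨g, hg⟩ := hθ _ (hsA Y hY)
      obtain ⟨β, hβ, kβ, eβ⟩ := definingForm_eq_formPoly (A.isHyperplane _ (hsA Y hY))
      -- Inside one group the images under `π` are proportional, so divisibility by their product
      -- must be proved before applying `π`, where the forms are still coprime. With `θ(β) = β g`
      -- and `γ = c β + e α`, one has `θ(γ) = γ g + e (θ(α) - α g)`, and `e` is a unit.
      have hdvd : ∏ H' ∈ (F Y).erase (s Y), definingForm H' ∣
          θ (formPoly α) - formPoly α * g := by
        have hF : ∀ H' ∈ (F Y).erase (s Y), H' ∈ A.planes := fun H' h =>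
          (Finset.mem_filter.mp (Finset.mem_of_mem_erase h)).1
        refine Finset.prod_dvd_of_isRelPrime (fun H₁ h₁ H₂ h₂ hne =>
          isRelPrime_definingForm (A.isHyperplane _ (hF _ h₁)) (A.isHyperplane _ (hF _ h₂)) hne)
          fun H' h' => ?_
        obtain ⟨γ, hγ, kγ, eγ⟩ := definingForm_eq_formPoly (A.isHyperplane _ (hF _ h'))
        have hY' : H' ⊓ H = Y := (Finset.mem_filter.mp (Finset.mem_of_mem_erase h')).2
        obtain ⟨c, e, he, rfl⟩ := exists_eq_smul_add_smul (α := α) (β := β) hγ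
          (by rw [kγ, kβ]; exact hY'.trans (hs Y hY).symm)
          (by rw [kγ, kβ]; exact Finset.ne_of_mem_erase h')
        have hd := hθ _ (hF _ h')
        rw [eβ] at hg
        rw [eγ, formPoly_add, formPoly_smul, formPoly_smul] at hd ⊢
        have : θ (C c * formPoly β + C e * formPoly α) =
            (C c * formPoly β + C e * formPoly α) * g +
              C e * (θ (formPoly α) - formPoly α * g) := by
          rw [map_add, ← smul_eq_C_mul, ← smul_eq_C_mul, Derivation.map_smul,
            Derivation.map_smul, hg]
          simp only [smul_eq_C_mul]
          ring
        rw [this, dvd_add_right (dvd_mul_right _ _)] at hd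
        exact (IsUnit.dvd_mul_left (he.isUnit.map C)).mp hd
      have h0 : π (formPoly α) = 0 := (hker _).mpr dvd_rfl
      simpa [h0] using map_dvd π hdvd

end CentralArrangement

end Elimination

end HypArr

namespace HypArr

open MvPolynomial

/-! ### Degree bounds for combinations of homogeneous polynomials. -/

section DegreeLemmas

variable {K : Type*} [Field K] {σ : Type*}

theorem coeff_mul_isHomogeneous_eq_zero {p g : MvPolynomial σ K} {d : ℕ}
    (hg : g.IsHomogeneous d) {m : σ →₀ ℕ} (hm : m.degree < d) : coeff m (p * g) = 0 := by
  classical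
  rw [coeff_mul]
  refine Finset.sum_eq_zero fun x hx => ?_
  have hx' := congrArg Finsupp.degree (Finset.HasAntidiagonal.mem_antidiagonal.mp hx)
  rw [map_add] at hx'
  rw [hg.coeff_eq_zero (by omega), mul_zero]

/-- Every monomial of the sum has degree at least `n`, whatever the coefficients `p i`, which need
not be homogeneous. -/
theorem eq_zero_of_totalDegree_lt {ι : Type*} {s : Finset ι} {p g : ι → MvPolynomial σ K}
    {d : ι → ℕ} {n : ℕ} (hg : ∀ i ∈ s, (g i).IsHomogeneous (d i)) (hd : ∀ i ∈ s, n ≤ d i)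
    (hn : (∑ i ∈ s, p i * g i).totalDegree < n) : ∑ i ∈ s, p i * g i = 0 := by
  ext m
  rw [coeff_zero]
  by_cases hm : m.degree < n
  · rw [coeff_sum]
    exact Finset.sum_eq_zero fun i hi =>
      coeff_mul_isHomogeneous_eq_zero (hg i hi) (hm.trans_le (hd i hi))
  · by_contra hc
    have := le_totalDegree (mem_support_iff.mpr hc)
    exact hm (lt_of_le_of_lt this hn)

theorem exists_eq_C_mul_of_dvd {f b : MvPolynomial σ K} {d n : ℕ} (hf : f.IsHomogeneous d)
    (hb : b.IsHomogeneous n) (hb0 : b ≠ 0) (hdn : d ≤ n) (h : b ∣ f) :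
    ∃ c : K, f = C c * b ∧ (c = 0 ∨ d = n) := by
  obtain ⟨q, rfl⟩ := h
  by_cases hq : q = 0
  · exact ⟨0, by simp [hq], Or.inl rfl⟩
  · have ht := hf.totalDegree (mul_ne_zero hb0 hq)
    rw [totalDegree_mul_of_isDomain hb0 hq, hb.totalDegree hb0] at ht
    have hqC := totalDegree_eq_zero_iff_eq_C.mp (show q.totalDegree = 0 by omega)
    exact ⟨coeff 0 q, by rw [← hqC, mul_comm], Or.inr (by omega)⟩

end DegreeLemmas

/-! ### Independence of the Euler derivation and two generators. -/

section Independence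

variable {K : Type*} [Field K] {l : ℕ}

theorem IsHomogeneousDer.sub_smul {θ ψ : Der K l} {d e : ℕ} (hθ : IsHomogeneousDer θ d)
    (hψ : IsHomogeneousDer ψ e) {k : K} (hk : k = 0 ∨ d = e) :
    IsHomogeneousDer (θ - k • ψ) d := by
  intro i
  rcases hk with rfl | rfl
  · simpa using hθ i
  · rw [Derivation.sub_apply, Derivation.smul_apply, smul_eq_C_mul]
    exact (hθ i).sub ((hψ i).C_mul k)

/-- A derivation of low degree that kills a linear form cannot be a nonzero combination of the
Euler derivation and derivations of higher degree. -/
theorem eq_zero_of_eq_combination {ψ : Der K l} {α : Module.Dual K (Fin l → K)} (hα : α ≠ 0)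
    (hψα : ψ (formPoly α) = 0) {n k : ℕ} (hdeg : ∀ i, ψ (X i) = 0 ∨ (ψ (X i)).totalDegree < n)
    {η : Fin k → Der K l} {d : Fin k → ℕ} (hη : ∀ i, IsHomogeneousDer (η i) (d i))
    (hd : ∀ i, n ≤ d i) (p₀ : CoordRing K l) (p : Fin k → CoordRing K l)
    (h : ψ = p₀ • eulerDer K l + ∑ i, p i • η i) : ψ = 0 := by
  have hval : ∀ i, ψ (X i) = p₀ * X i + ∑ a, p a * η a (X i) := by
    intro i
    conv_lhs => rw [h]
    rw [Derivation.add_apply, ← Derivation.coeFnAddMonoidHom_apply (∑ a, p a • η a), map_sum,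
      Finset.sum_apply]
    simp [eulerDer_X]
  have hlt : ∀ i j, (X j * ψ (X i)).totalDegree < n + 1 := by
    intro i j
    rcases hdeg i with h0 | h0
    · simp [h0]
    · have := totalDegree_mul (X j) (ψ (X i))
      rw [totalDegree_X] at this
      omega
  -- The 2×2 minors against `θ_E` eliminate the unknown `p₀`. They have degree below `n + 1`, yet
  -- combine forms of degree at least `n + 1`, so they vanish and `ψ` is parallel to `θ_E`.
  have hminor : ∀ i j, X j * ψ (X i) = X i * ψ (X j) := by
    intro i j
    have e : X j * ψ (X i) - X i * ψ (X j) =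
        ∑ a, p a * (X j * η a (X i) - X i * η a (X j)) := by
      rw [hval i, hval j]
      simp only [mul_add, mul_sub, Finset.mul_sum, Finset.sum_sub_distrib]
      have h1 : ∀ u v : Fin l, ∑ a, p a * (X u * η a (X v)) = ∑ a, X u * (p a * η a (X v)) :=
        fun u v => Finset.sum_congr rfl fun a _ => by ring
      rw [h1, h1]
      ring
    have hz := eq_zero_of_totalDegree_lt (s := Finset.univ) (p := p)
      (g := fun a => X j * η a (X i) - X i * η a (X j)) (d := fun a => 1 + d a) (n := n + 1)
      (fun a _ => ((isHomogeneous_X K j).mul (hη a i)).sub ((isHomogeneous_X K i).mul (hη a j)))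
      (fun a _ => by have := hd a; omega)
      (by rw [← e]; exact (totalDegree_sub _ _).trans_lt (max_lt (hlt i j) (hlt j i)))
    exact sub_eq_zero.mp (e.trans hz)
  refine derivation_ext fun j => ?_
  have h0 : formPoly α * ψ (X j) = 0 := by
    calc formPoly α * ψ (X j) = X j * ψ (formPoly α) := by
          rw [derivation_formPoly, formPoly, Finset.sum_mul, Finset.mul_sum]
          refine Finset.sum_congr rfl fun i _ => ?_
          rw [mul_assoc, ← hminor i j]
          ring
      _ = 0 := by rw [hψα, mul_zero]
  exact (mul_eq_zero.mp h0).resolve_left (formPoly_ne_zero hα)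

namespace CentralArrangement

/-- The Euler derivation and the two generators of smallest degree are linearly independent. -/
theorem linearIndependent_of_generators (A : CentralArrangement K l) (hA : A.planes.Nonempty)
    {θ₁ θ₂ θ₃ : Der K l} {d₁ d₂ d₃ : ℕ} (hθ₁ : IsHomogeneousDer θ₁ d₁)
    (hθ₂ : IsHomogeneousDer θ₂ d₂) (hθ₃ : IsHomogeneousDer θ₃ d₃)
    (h12 : d₁ ≤ d₂) (h13 : d₁ ≤ d₃) (hm₁ : θ₁ ∈ A.logDer) (hm₂ : θ₂ ∈ A.logDer)
    (hgen : ∀ ψ ∈ A.logDer, ∃ p q r s : CoordRing K l,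
      ψ = p • eulerDer K l + q • θ₁ + r • θ₂ + s • θ₃)
    (hn₁ : ∀ p : CoordRing K l, θ₁ ≠ p • eulerDer K l)
    (hn₂ : ∀ p q : CoordRing K l, θ₂ ≠ p • eulerDer K l + q • θ₁) :
    LinearIndependent (CoordRing K l) ![eulerDer K l, θ₁, θ₂] := by
  obtain ⟨H, hH⟩ := hA
  obtain ⟨α, hα, -, eα⟩ := definingForm_eq_formPoly (A.isHyperplane H hH)
  have hα0 := formPoly_ne_zero hα
  obtain ⟨g₁, hg₁⟩ := (A.mem_logDer_iff θ₁).mp hm₁ H hH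
  obtain ⟨g₂, hg₂⟩ := (A.mem_logDer_iff θ₂).mp hm₂ H hH
  rw [eα] at hg₁ hg₂
  -- Subtracting these multiples of `θ_E` makes both derivations kill `α`, so no nonzero combination
  -- of them can be parallel to `θ_E`.
  set η₁ := θ₁ - g₁ • eulerDer K l with hη₁
  set η₂ := θ₂ - g₂ • eulerDer K l with hη₂
  have hη₁α : η₁ (formPoly α) = 0 := by
    rw [hη₁, Derivation.sub_apply, Derivation.smul_apply, eulerDer_formPoly, hg₁, smul_eq_mul]
    ring
  have hη₂α : η₂ (formPoly α) = 0 := by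
    rw [hη₂, Derivation.sub_apply, Derivation.smul_apply, eulerDer_formPoly, hg₂, smul_eq_mul]
    ring
  have hη₁D : η₁ ∈ A.logDer := sub_mem hm₁ (A.logDer.smul_mem _ A.eulerDer_mem_logDer)
  have hη₂D : η₂ ∈ A.logDer := sub_mem hm₂ (A.logDer.smul_mem _ A.eulerDer_mem_logDer)
  have hη₁0 : η₁ ≠ 0 := fun h => hn₁ g₁ (sub_eq_zero.mp h)
  have hη₂0 : ∀ q : CoordRing K l, η₂ ≠ q • η₁ := by
    intro q h
    refine hn₂ (g₂ - q * g₁) q ?_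
    rw [← sub_add_cancel θ₂ (g₂ • eulerDer K l), ← hη₂, h, hη₁]
    module
  have htf : ∀ (c : CoordRing K l) (ψ : Der K l), c • ψ = 0 → c = 0 ∨ ψ = 0 := by
    intro c ψ h
    by_cases hc : c = 0
    · exact Or.inl hc
    · refine Or.inr (derivation_ext fun i => ?_)
      have := congrArg (fun D : Der K l => D (X i)) h
      exact (mul_eq_zero.mp (by simpa using this)).resolve_left hc
  have hkey : ∀ b c : CoordRing K l, b • η₁ + c • η₂ = 0 → b = 0 ∧ c = 0 := by
    intro b c hbc
    by_contra hne
    have hb : b ≠ 0 := by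
      rintro rfl
      rw [zero_smul, zero_add] at hbc
      rcases htf _ _ hbc with h | h
      · exact hne ⟨rfl, h⟩
      · exact hη₂0 0 (by rw [h, zero_smul])
    -- With coprime coefficients, `c'` must divide `η₁`; the quotient `ψ` divides both `η₁` and
    -- `η₂`.
    obtain ⟨b', c', g, hrel, rfl, rfl⟩ := UniqueFactorizationMonoid.exists_reduced_factors b hb c
    have hbc' : b' • η₁ + c' • η₂ = 0 := by
      refine (htf g _ ?_).resolve_left (left_ne_zero_of_mul hb)
      rw [smul_add, smul_smul, smul_smul, hbc]
    have hb' : b' ≠ 0 := right_ne_zero_of_mul hb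
    have hc' : c' ≠ 0 := by
      rintro rfl
      rw [zero_smul, add_zero] at hbc'
      exact (htf _ _ hbc').elim hb' hη₁0
    have hdvd : ∀ i, c' ∣ η₁ (X i) := by
      intro i
      have h := congrArg (fun D : Der K l => D (X i)) hbc'
      have h' : b' * η₁ (X i) + c' * η₂ (X i) = 0 := by simpa using h
      refine hrel.symm.dvd_of_dvd_mul_left ⟨-η₂ (X i), ?_⟩
      linear_combination h'
    choose f hf using hdvd
    set ψ : Der K l := mkDerivation K f with hψ
    have hψ₁ : η₁ = c' • ψ := derivation_ext fun i => by simp [hf i, hψ, mkDerivation_X]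
    have hψ₂ : η₂ = -(b' • ψ) := by
      refine sub_eq_zero.mp ((htf c' _ ?_).resolve_left hc')
      rw [hψ₁] at hbc'
      rw [← hbc']
      module
    -- A unit `c'` would make `η₂` a multiple of `η₁`, against minimality. So dividing by `c'`
    -- strictly lowers the degree.
    have hc'u : ¬ IsUnit c' := by
      rintro ⟨u, rfl⟩
      refine hη₂0 (-(b' * ↑u⁻¹)) ?_
      rw [hψ₁, hψ₂, smul_smul, neg_mul, mul_assoc, Units.inv_mul, mul_one, neg_smul]
    -- A prime `α_{H'}` cannot divide both `b'` and `c'`, so one of the two memberships passes to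
    -- `ψ`.
    have hψD : ψ ∈ A.logDer := by
      rw [mem_logDer_iff] at hη₁D hη₂D ⊢
      intro H' hH'
      have hp := prime_definingForm (A.isHyperplane H' hH')
      have e₁ := hη₁D H' hH'
      have e₂ := hη₂D H' hH'
      rw [hψ₁, Derivation.smul_apply, smul_eq_mul] at e₁
      rw [hψ₂, Derivation.neg_apply, Derivation.smul_apply, smul_eq_mul, dvd_neg] at e₂
      rcases hp.dvd_or_dvd e₁ with h | h
      · rcases hp.dvd_or_dvd e₂ with h' | h'
        · exact absurd (hrel h' h) hp.not_isUnit
        · exact h'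
      · exact h
    have hψα : ψ (formPoly α) = 0 := by
      rw [hψ₁, Derivation.smul_apply, smul_eq_mul] at hη₁α
      exact (mul_eq_zero.mp hη₁α).resolve_left hc'
    -- Homogeneity of `g₁` is not established; bounds on total degree suffice.
    have hg₁deg : g₁ = 0 ∨ g₁.totalDegree + 1 ≤ d₁ := by
      by_cases h0 : g₁ = 0
      · exact Or.inl h0
      · right
        have h := (isHomogeneous_derivation_formPoly hθ₁ α).totalDegree_le
        rw [hg₁, totalDegree_mul_of_isDomain hα0 h0,
          (formPoly_isHomogeneous α).totalDegree hα0] at h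
        omega
    have hη₁deg : ∀ i, (η₁ (X i)).totalDegree ≤ d₁ := by
      intro i
      rw [hη₁, Derivation.sub_apply, Derivation.smul_apply, eulerDer_X, smul_eq_mul]
      refine (totalDegree_sub _ _).trans (max_le (hθ₁ i).totalDegree_le ?_)
      rcases hg₁deg with h | h
      · simp [h]
      · have := totalDegree_mul g₁ (X i)
        rw [totalDegree_X] at this
        omega
    have hψdeg : ∀ i, ψ (X i) = 0 ∨ (ψ (X i)).totalDegree < d₁ := by
      intro i
      by_cases h0 : ψ (X i) = 0
      · exact Or.inl h0
      · right
        have h := hη₁deg i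
        rw [hψ₁, Derivation.smul_apply, smul_eq_mul, totalDegree_mul_of_isDomain hc' h0] at h
        have hc1 : c'.totalDegree ≠ 0 := by
          intro hz
          have hC := totalDegree_eq_zero_iff_eq_C.mp hz
          refine hc'u ?_
          rw [hC] at hc' ⊢
          exact (IsUnit.mk0 _ (fun h => hc' (by rw [h, C_0]))).map C
        omega
    obtain ⟨p, q, r, s, hcomb⟩ := hgen ψ hψD
    have hψ0 : ψ = 0 := by
      refine eq_zero_of_eq_combination hα hψα hψdeg (η := ![θ₁, θ₂, θ₃]) (d := ![d₁, d₂, d₃])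
        ?_ ?_ p ![q, r, s] ?_
      · intro i
        fin_cases i
        exacts [hθ₁, hθ₂, hθ₃]
      · intro i
        fin_cases i
        exacts [le_rfl, h12, h13]
      · rw [hcomb]
        simp [Fin.sum_univ_three, add_assoc]
    exact hη₁0 (by rw [hψ₁, hψ0, smul_zero])
  rw [Fintype.linearIndependent_iff]
  intro w hw
  simp only [Fin.sum_univ_three, Matrix.cons_val] at hw
  -- Evaluating the relation at `α` shows that its `θ_E` part vanishes when it is rewritten in `η₁`
  -- and `η₂`.
  have hw0 : w 0 + w 1 * g₁ + w 2 * g₂ = 0 := by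
    have h := congrArg (fun D : Der K l => D (formPoly α)) hw
    simp only [Derivation.add_apply, Derivation.smul_apply, smul_eq_mul, eulerDer_formPoly, hg₁,
      hg₂, Derivation.zero_apply] at h
    refine (mul_eq_zero.mp ?_).resolve_left hα0
    linear_combination h
  obtain ⟨hw1, hw2⟩ := hkey (w 1) (w 2) (by
    calc w 1 • η₁ + w 2 • η₂ = (w 0 • eulerDer K l + w 1 • θ₁ + w 2 • θ₂) -
          (w 0 + w 1 * g₁ + w 2 * g₂) • eulerDer K l := by
            rw [hη₁, hη₂]
            module
      _ = 0 := by rw [hw, hw0, zero_smul, sub_zero])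
  rw [hw1, hw2, zero_mul, zero_mul, add_zero, add_zero] at hw0
  intro i
  fin_cases i
  exacts [hw0, hw1, hw2]

end CentralArrangement

end Independence

end HypArr

namespace HypArr

open MvPolynomial

/-! ### Correcting the generators to be logarithmic along `H`. -/

section Addition

variable {K : Type*} [Field K]

namespace CentralArrangement

/-- Here `θ₃` is the pivot used to cancel the values on `H`. The generators enter separately so that
generators of equal degree can be permuted when this is applied. -/
theorem isFreeWithExponents_addPlane_of_restriction_values (A : CentralArrangement K 3)
    (hA : A.planes.Nonempty) {θ₁ θ₂ θ₃ : Der K 3} {d₁ d₂ d₃ : ℕ}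
    (hθ₁ : IsHomogeneousDer θ₁ d₁) (hθ₂ : IsHomogeneousDer θ₂ d₂) (hθ₃ : IsHomogeneousDer θ₃ d₃)
    (h1 : 1 ≤ d₁) (h12 : d₁ ≤ d₂) (h23 : d₂ ≤ d₃)
    (hm₁ : θ₁ ∈ A.logDer) (hm₂ : θ₂ ∈ A.logDer) (hm₃ : θ₃ ∈ A.logDer)
    (hgen : ∀ ψ ∈ A.logDer, ∃ p q r s : CoordRing K 3,
      ψ = p • eulerDer K 3 + q • θ₁ + r • θ₂ + s • θ₃)
    (hn₁ : ∀ p q r : CoordRing K 3, θ₁ ≠ p • eulerDer K 3 + q • θ₂ + r • θ₃)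
    (hn₂ : ∀ p q r : CoordRing K 3, θ₂ ≠ p • eulerDer K 3 + q • θ₁ + r • θ₃)
    {α : Module.Dual K (Fin 3 → K)} (hH : IsHyperplane (LinearMap.ker α))
    (hα : ∀ θ : Der K 3, formPoly α ∣ θ (formPoly α) →
      definingForm (LinearMap.ker α) ∣ θ (definingForm (LinearMap.ker α)))
    {π : CoordRing K 3 →ₐ[K] CoordRing K 3} (hker : ∀ f, π f = 0 ↔ formPoly α ∣ f)
    {b : CoordRing K 3} {c₁ c₂ c₃ : K}
    (e₁ : π (θ₁ (formPoly α)) = C c₁ * b) (e₂ : π (θ₂ (formPoly α)) = C c₂ * b)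
    (e₃ : π (θ₃ (formPoly α)) = C c₃ * b)
    (hc₁ : c₁ = 0 ∨ d₁ = d₃) (hc₂ : c₂ = 0 ∨ d₂ = d₃) (hc : c₃ = 0 → c₁ = 0 ∧ c₂ = 0)
    (hcard : 1 + d₁ + d₂ = (A.addPlane _ hH).card) :
    (A.addPlane _ hH).IsFreeWithExponents ![1, d₁, d₂] := by
  have hk : ∀ {c : K} {d : ℕ}, c = 0 ∨ d = d₃ → c / c₃ = 0 ∨ d = d₃ := by
    rintro c d (h | h)
    · exact Or.inl (by rw [h, zero_div])
    · exact Or.inr h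
  have hmem : ∀ {θ : Der K 3} {c : K}, θ ∈ A.logDer → π (θ (formPoly α)) = C c * b →
      (c₃ = 0 → c = 0) → θ - (c / c₃) • θ₃ ∈ (A.addPlane _ hH).logDer := by
    intro θ c hθ e hc
    rw [mem_logDer_addPlane_iff]
    refine ⟨hα _ ?_, sub_mem hθ (A.logDer.smul_of_tower_mem _ hm₃)⟩
    rw [← hker, Derivation.sub_apply, Derivation.smul_apply, map_sub, map_smul, e, e₃,
      smul_eq_C_mul, ← mul_assoc, ← C_mul, ← sub_mul, ← C_sub]
    -- For `c₃ = 0` the quotient `c / c₃` is zero by convention; `c` is then zero too, so the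
    -- uncorrected `θ` already works.
    by_cases h0 : c₃ = 0
    · simp [h0, hc h0]
    · simp [div_mul_cancel₀ c h0]
  have hm₁' := hmem hm₁ e₁ fun h => (hc h).1
  have hm₂' := hmem hm₂ e₂ fun h => (hc h).2
  have hh₁ := hθ₁.sub_smul hθ₃ (hk hc₁)
  have hh₂ := hθ₂.sub_smul hθ₃ (hk hc₂)
  generalize c₁ / c₃ = k₁ at hm₁' hh₁
  generalize c₂ / c₃ = k₂ at hm₂' hh₂
  have hC : ∀ (k : K), k • θ₃ = (C k : CoordRing K 3) • θ₃ := fun k => by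
    rw [← algebraMap_eq, algebraMap_smul]
  have hli : LinearIndependent (CoordRing K 3) ![eulerDer K 3, θ₁ - k₁ • θ₃, θ₂ - k₂ • θ₃] := by
    refine A.linearIndependent_of_generators hA hh₁ hh₂ hθ₃ h12 (h12.trans h23)
      ((A.mem_logDer_addPlane_iff hH _).mp hm₁').2 ((A.mem_logDer_addPlane_iff hH _).mp hm₂').2
      (fun ψ hψ => ?_) (fun p h => ?_) fun p q h => ?_
    -- The corrections are multiples of `θ₃`, which stays in the list, so generation and
    -- irredundancy survive.
    · obtain ⟨p, q, r, s, rfl⟩ := hgen ψ hψ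
      refine ⟨p, q, r, s + q * C k₁ + r * C k₂, ?_⟩
      rw [hC, hC]
      module
    · refine hn₁ p 0 (C k₁) ?_
      rw [← sub_add_cancel θ₁ (k₁ • θ₃), h, hC]
      module
    · refine hn₂ p q (C k₂ - q * C k₁) ?_
      rw [← sub_add_cancel θ₂ (k₂ • θ₃), h, hC, hC]
      module
  refine isFreeWithExponents_of_linearIndependent _ (θ := ![eulerDer K 3, _, _])
    (fun i => ?_) (fun i => ?_) hli ?_ ?_
  · fin_cases i
    exacts [eulerDer_mem_logDer _, hm₁', hm₂']
  · fin_cases i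
    exacts [isHomogeneousDer_eulerDer, hh₁, hh₂]
  · simpa [Fin.sum_univ_three] using hcard
  · rw [Fin.monotone_iff_le_succ]
    intro i
    fin_cases i
    exacts [h1, h12]

end CentralArrangement

end Addition

end HypArr

/-! ### The addition theorem: choosing the pivot generator. -/

open HypArr HypArr.CentralArrangement in
theorem mainTheorem7 {K : Type*} [Field K] [CharZero K]
    (A' : HypArr.CentralArrangement K 3)
    (d₁ d₂ d₃ : ℕ) (θ₁ θ₂ θ₃ : HypArr.Der K 3)
    (hgen : A'.IsMinimalGenerators ![HypArr.eulerDer K 3, θ₁, θ₂, θ₃] ![1, d₁, d₂, d₃])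
    (h1 : 1 ≤ d₁) (h12 : d₁ ≤ d₂) (h23 : d₂ ≤ d₃)
    (H : Submodule K (Fin 3 → K)) (hH : HypArr.IsHyperplane H) (hHA' : H ∉ A'.planes)
    (hres : (A'.card : ℤ) - (((A'.addPlane H hH).restriction H).card : ℤ) = (d₃ : ℤ))
    (hcard : 1 + d₁ + d₂ = (A'.addPlane H hH).card) :
    (A'.addPlane H hH).IsFreeWithExponents ![1, d₁, d₂] := by
  classical
  have hcardA : (A'.addPlane H hH).card = A'.card + 1 := Finset.card_insert_of_notMem hHA'
  have hA : A'.planes.Nonempty := by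
    rw [← Finset.card_pos]
    have : A'.planes.card = A'.card := rfl
    omega
  have hθ₁ : IsHomogeneousDer θ₁ d₁ := hgen.homogeneous 1
  have hθ₂ : IsHomogeneousDer θ₂ d₂ := hgen.homogeneous 2
  have hθ₃ : IsHomogeneousDer θ₃ d₃ := hgen.homogeneous 3
  have hm : ∀ i, ![eulerDer K 3, θ₁, θ₂, θ₃] i ∈ A'.logDer := fun i => by
    rw [← hgen.span_eq]
    exact Submodule.subset_span (Set.mem_range_self i)
  have hm₁ : θ₁ ∈ A'.logDer := hm 1
  have hm₂ : θ₂ ∈ A'.logDer := hm 2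
  have hm₃ : θ₃ ∈ A'.logDer := hm 3
  have hg : ∀ ψ ∈ A'.logDer, ∃ p q r s : CoordRing K 3,
      ψ = p • eulerDer K 3 + q • θ₁ + r • θ₂ + s • θ₃ := by
    intro ψ hψ
    rw [← hgen.span_eq, Submodule.mem_span_range_iff_exists_fun] at hψ
    obtain ⟨c, rfl⟩ := hψ
    exact ⟨c 0, c 1, c 2, c 3, by simp [Fin.sum_univ_four]⟩
  have hirr : ∀ i j k m : Fin 4, j ≠ i → k ≠ i → m ≠ i → ∀ p q r : CoordRing K 3,
      ![eulerDer K 3, θ₁, θ₂, θ₃] i ≠ p • ![eulerDer K 3, θ₁, θ₂, θ₃] j +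
        q • ![eulerDer K 3, θ₁, θ₂, θ₃] k + r • ![eulerDer K 3, θ₁, θ₂, θ₃] m := by
    intro i j k m hj hk hm p q r h
    refine hgen.irredundant i ?_
    rw [h]
    have hs : ∀ n : Fin 4, n ≠ i → ![eulerDer K 3, θ₁, θ₂, θ₃] n ∈
        Submodule.span (CoordRing K 3) (![eulerDer K 3, θ₁, θ₂, θ₃] '' {i}ᶜ) := fun n hn =>
      Submodule.subset_span (Set.mem_image_of_mem _ hn)
    exact add_mem (add_mem (Submodule.smul_mem _ _ (hs j hj)) (Submodule.smul_mem _ _ (hs k hk)))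
      (Submodule.smul_mem _ _ (hs m hm))
  obtain ⟨α, hα, rfl, eα⟩ := definingForm_eq_formPoly hH
  obtain ⟨π, hker, hhom, hform⟩ := exists_elimination hα
  obtain ⟨b, n, hb0, hb, hn, hdvd⟩ := A'.exists_dvd_elimination hHA' hH hker hform
  obtain rfl : n = d₃ := by omega
  have hval : ∀ {θ : Der K 3} {d : ℕ}, IsHomogeneousDer θ d → θ ∈ A'.logDer → d ≤ n →
      ∃ c : K, π (θ (formPoly α)) = MvPolynomial.C c * b ∧ (c = 0 ∨ d = n) := fun hθ hmθ hd =>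
    exists_eq_C_mul_of_dvd (hhom _ _ (isHomogeneous_derivation_formPoly hθ α)) hb hb0 hd
      (hdvd _ hmθ)
  obtain ⟨c₁, e₁, hc₁⟩ := hval hθ₁ hm₁ (h12.trans h23)
  obtain ⟨c₂, e₂, hc₂⟩ := hval hθ₂ hm₂ h23
  obtain ⟨c₃, e₃, -⟩ := hval hθ₃ hm₃ le_rfl
  have hα' : ∀ θ : Der K 3, formPoly α ∣ θ (formPoly α) →
      definingForm (LinearMap.ker α) ∣ θ (definingForm (LinearMap.ker α)) := fun θ h => by
    rwa [eα]
  -- Otherwise `c₃ = 0` and some other `cᵢ` is nonzero. Then `dᵢ = d₃`, and `θᵢ` trades places with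
  -- `θ₃` without changing the degrees.
  by_cases h : c₃ = 0 → c₁ = 0 ∧ c₂ = 0
  · exact A'.isFreeWithExponents_addPlane_of_restriction_values hA hθ₁ hθ₂ hθ₃ h1 h12 h23
      hm₁ hm₂ hm₃ hg (hirr 1 0 2 3 (by decide) (by decide) (by decide))
      (hirr 2 0 1 3 (by decide) (by decide) (by decide)) hH hα' hker e₁ e₂ e₃ hc₁ hc₂ h hcard
  · push Not at h
    obtain ⟨-, h⟩ := h
    by_cases h2 : c₂ = 0
    · have h10 : c₁ ≠ 0 := fun h0 => h h0 h2
      obtain rfl : d₁ = n := hc₁.resolve_left h10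
      obtain rfl : d₁ = d₂ := le_antisymm h12 h23
      exact A'.isFreeWithExponents_addPlane_of_restriction_values hA hθ₃ hθ₂ hθ₁ h1 h12 h23
        hm₃ hm₂ hm₁ (fun ψ hψ => by
          obtain ⟨p, q, r, s, rfl⟩ := hg ψ hψ
          exact ⟨p, s, r, q, by abel⟩)
        (hirr 3 0 2 1 (by decide) (by decide) (by decide))
        (hirr 2 0 3 1 (by decide) (by decide) (by decide)) hH hα' hker e₃ e₂ e₁
        (Or.inr rfl) (Or.inr rfl) (fun h0 => absurd h0 h10) hcard
    · obtain rfl : d₂ = n := hc₂.resolve_left h2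
      exact A'.isFreeWithExponents_addPlane_of_restriction_values hA hθ₁ hθ₃ hθ₂ h1 h12 h23
        hm₁ hm₃ hm₂ (fun ψ hψ => by
          obtain ⟨p, q, r, s, rfl⟩ := hg ψ hψ
          exact ⟨p, q, s, r, by abel⟩)
        (hirr 1 0 3 2 (by decide) (by decide) (by decide))
        (hirr 3 0 1 2 (by decide) (by decide) (by decide)) hH hα' hker e₁ e₃ e₂
        hc₁ (Or.inr rfl) (fun h0 => absurd h0 h2) hcard
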